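/- **Setting.** Fix a coefficient field. For a finite set $S$ of points, the Rips filtration has at scale $r$ the nonempty $\sigma\subseteq S$ with diameter at most $r$. The Čech filtration of a finite subset $S$ of a real normed space (for example $\mathbb{R}^d$) has at scale $r$ the nonempty $\sigma\subseteq S$ such that the closed balls of radius $cr$ of the ambient space around the points of $\sigma$ have a common point, where $c\in\{\tfrac12,1\}$ is either one of the two customary normalizations, the same for all point sets. Let $\lambda^1(S)$ be the collection of persistence diagrams, one for each homological degree, of the filtration of $1$-skeleta (simplices with at most two vertices) of the Rips, respectively Čech, filtration of $S$. For two diagrams let $W^1$ be the $1$-Wasserstein distance with $\ell^\infty$ ground metric: the infimum, over all partial matchings of the dots, of the sum of the $\ell^\infty$ distances of matched dots and the $\ell^\infty$ distances of unmatched dots to the diagonal. Let $W^1(\lambda^1(S),\lambda^1(T))$ be the maximum of the $W^1$ distances over all homological degrees. **Theorem.** Let $\lambda$ be Rips persistence, with $X$ and $Y$ subsets of arbitrary metric spaces, or Čech persistence, with $X$ and $Y$ subsets of (possibly different) real normed spaces. Let $k\ge 2$ be an integer, let $\varepsilon_1\ge 0$ and $\varepsilon_2$ be real numbers, and let $\phi:X\to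 Y$ be a bijection such that $$W^1(\lambda^1(S),\lambda^1(\phi(S)))\le\varepsilon_1\qquad\text{for all } S\subseteq X \text{ with } |S|\in\{k,k-1\}.$$ Suppose further that there is a subset $X'\subseteq X$ with $|X'|=k-1$ and $$\sum_{(x,x')\in X'\times X'}\bigl|d(x,x')-d(\phi(x),\phi(x'))\bigr|\le\varepsilon_2 .$$ Then $\phi$ is a $\bigl(56(k+1)\varepsilon_1+28\varepsilon_2\bigr)$-quasi-isometry, that is, $$|d(x_1,x_2)-d(\phi(x_1),\phi(x_2))|\le 56(k+1)\varepsilon_1+28\varepsilon_2\qquad\text{for all } x_1,x_2\in X .$$ -/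

import Mathlib

open scoped ENNReal

noncomputable section

namespace DistPers

universe u v

/-! ### Simplicial chains and persistent Betti numbers -/

/-- Chains with coefficients in `𝕜` on the full simplex with vertex set `V` (all degrees together). -/
abbrev Chain (𝕜 : Type v) [Field 𝕜] (V : Type u) : Type (max u v) := Finset V →₀ 𝕜

open Classical in
/-- The signed boundary of the simplex `σ`, where simplices are oriented by a fixed well-order of
the vertices.  The empty face is left out, so this leads to unreduced homology. -/
def simplexBoundary (𝕜 : Type v) [Field 𝕜] {V : Type u} (σ : Finset V) : Chain 𝕜 V :=
  ∑ x ∈ σ, if (σ.erase x).Nonempty then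
      Finsupp.single (σ.erase x) ((-1 : 𝕜) ^ (σ.filter fun y => WellOrderingRel y x).card)
    else 0

/-- The boundary operator. -/
def boundary (𝕜 : Type v) [Field 𝕜] (V : Type u) : Chain 𝕜 V →ₗ[𝕜] Chain 𝕜 V :=
  Finsupp.linearCombination 𝕜 (simplexBoundary 𝕜)

/-- The `n`-chains of a simplicial complex. -/
def chains (𝕜 : Type v) [Field 𝕜] {V : Type u} (n : ℕ) (K : PreAbstractSimplicialComplex V) :
    Submodule 𝕜 (Chain 𝕜 V) :=
  Finsupp.supported 𝕜 𝕜 {σ | σ ∈ K ∧ σ.card = n + 1}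

/-- The `n`-cycles of a simplicial complex. -/
def cycles (𝕜 : Type v) [Field 𝕜] {V : Type u} (n : ℕ) (K : PreAbstractSimplicialComplex V) :
    Submodule 𝕜 (Chain 𝕜 V) :=
  chains 𝕜 n K ⊓ LinearMap.ker (boundary 𝕜 V)

/-- The `n`-boundaries of a simplicial complex. -/
def boundaries (𝕜 : Type v) [Field 𝕜] {V : Type u} (n : ℕ) (K : PreAbstractSimplicialComplex V) :
    Submodule 𝕜 (Chain 𝕜 V) :=
  (chains 𝕜 (n + 1) K).map (boundary 𝕜 V)

/-- The persistent Betti number of `K ≤ L`: the rank of `H_n(K) → H_n(L)`, computed as the dimension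
of the image of `Z_n(K)` in the quotient of all chains by `B_n(L)`, which is
`Z_n(K) / (Z_n(K) ∩ B_n(L))`. -/
def persistentBetti (𝕜 : Type v) [Field 𝕜] {V : Type u} (n : ℕ)
    (K L : PreAbstractSimplicialComplex V) : ℕ :=
  Module.finrank 𝕜 ((cycles 𝕜 n K).map (boundaries 𝕜 n L).mkQ)

/-! ### Filtrations and persistence diagrams -/

/-- A filtered simplicial complex: an increasing family of complexes indexed by the scale. -/
abbrev Filtration (V : Type u) : Type u := ℝ →o PreAbstractSimplicialComplex V

/-- The complex just before scale `r`. -/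
def Filtration.before {V : Type u} (K : Filtration V) (r : ℝ) : PreAbstractSimplicialComplex V :=
  ⨆ s : Set.Iio r, K s

/-- The complex of all simplices that appear at some scale. -/
def Filtration.total {V : Type u} (K : Filtration V) : PreAbstractSimplicialComplex V :=
  ⨆ s : ℝ, K s

/-- A possible dot `(birth, death)` of a persistence diagram; the death may be `∞ = ⊤`. -/
abbrev Dot : Type := ℝ × WithTop ℝ

/-- The multiplicity of a dot in the degree `n` persistence diagram, given by the usual alternating
sum of persistent Betti numbers: the number of classes that are born exactly at `b` and die exactly
at `d`. -/
def dotMultiplicity (𝕜 : Type v) [Field 𝕜] {V : Type u} (K : Filtration V) (n : ℕ) : Dot → ℕ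
  | (b, (d : ℝ)) =>
    if b < d then
      (((persistentBetti 𝕜 n (K b) (K.before d) : ℤ)
          - persistentBetti 𝕜 n (K.before b) (K.before d))
        - ((persistentBetti 𝕜 n (K b) (K d) : ℤ)
          - persistentBetti 𝕜 n (K.before b) (K d))).toNat
    else 0
  | (b, ⊤) =>
    ((persistentBetti 𝕜 n (K b) K.total : ℤ) - persistentBetti 𝕜 n (K.before b) K.total).toNat

/-- The degree `n` persistence diagram (off the diagonal) of a filtration of a finite complex, as a
multiset of dots. -/
def diagram (𝕜 : Type v) [Field 𝕜] {V : Type u} (K : Filtration V) (n : ℕ) : Multiset Dot :=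
  ∑ᶠ p : Dot, Multiset.replicate (dotMultiplicity 𝕜 K n p) p

/-! ### The 1-Wasserstein distance -/

/-- The distance of two death times; `∞` is at distance `0` from itself and at infinite distance
from every real number. -/
def deathDist : WithTop ℝ → WithTop ℝ → ℝ≥0∞
  | (d : ℝ), (d' : ℝ) => ENNReal.ofReal |d - d'|
  | ⊤, ⊤ => 0
  | (_ : ℝ), ⊤ => ⊤
  | ⊤, (_ : ℝ) => ⊤

/-- The `ℓ^∞` distance of two dots. -/
def dotDist (p q : Dot) : ℝ≥0∞ := max (ENNReal.ofReal |p.1 - q.1|) (deathDist p.2 q.2)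

/-- The `ℓ^∞` distance of a dot to the diagonal. -/
def diagonalDist : Dot → ℝ≥0∞
  | (b, (d : ℝ)) => ENNReal.ofReal (|d - b| / 2)
  | (_, ⊤) => ⊤

/-- The 1-Wasserstein distance of two finite diagrams: the least total cost of a partial matching
`M`, where the unmatched dots `A'` of `A` and `B'` of `B` are moved to the diagonal. -/
def wassersteinOne (A B : Multiset Dot) : ℝ≥0∞ :=
  ⨅ (M : Multiset (Dot × Dot)) (A' : Multiset Dot) (B' : Multiset Dot)
    (_ : M.map Prod.fst + A' = A) (_ : M.map Prod.snd + B' = B),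
    (M.map fun q => dotDist q.1 q.2).sum + (A'.map diagonalDist).sum + (B'.map diagonalDist).sum

/-- The 1-Wasserstein distance of the persistence of two filtrations: the maximum over all
homological degrees. -/
def persistenceDist (𝕜 : Type*) [Field 𝕜] {V W : Type*} (K : Filtration V) (L : Filtration W) :
    ℝ≥0∞ :=
  ⨆ n : ℕ, wassersteinOne (diagram 𝕜 K n) (diagram 𝕜 L n)

/-! ### Skeleta, Rips and Čech filtrations -/

/-- The `m`-skeleton of a filtered complex. -/
def skeleton {V : Type u} (m : ℕ) (K : Filtration V) : Filtration V where
  toFun r :=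
    { faces := {σ | σ ∈ K r ∧ σ.card ≤ m + 1}
      isRelLowerSet_faces := fun _ hσ => ⟨((K r).isRelLowerSet_faces hσ.1).1, fun _ hτ hne =>
        ⟨((K r).isRelLowerSet_faces hσ.1).2 hτ hne, (Finset.card_le_card hτ).trans hσ.2⟩⟩ }
  monotone' _ _ h := fun _ hσ => ⟨K.monotone h hσ.1, hσ.2⟩

/-- The Rips filtration of `S`: at scale `r`, the nonempty subsets of diameter at most `r`. -/
def rips {E : Type u} [MetricSpace E] (S : Finset E) : Filtration E where
  toFun r :=
    { faces := {σ | σ.Nonempty ∧ σ ⊆ S ∧ ∀ x ∈ σ, ∀ y ∈ σ, dist x y ≤ r}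
      isRelLowerSet_faces := fun _ hσ => ⟨hσ.1, fun _ hτ hne =>
        ⟨hne, hτ.trans hσ.2.1, fun x hx y hy => hσ.2.2 x (hτ hx) y (hτ hy)⟩⟩ }
  monotone' _ _ h := fun _ hσ =>
    ⟨hσ.1, hσ.2.1, fun x hx y hy => (hσ.2.2 x hx y hy).trans h⟩

/-- The Čech filtration of `S` in the ambient space `E`: at scale `r`, the nerve of the closed balls
of radius `c * r` in `E` around the points of `S`.  The customary normalizations are `c = 1` (the
scale is the radius) and `c = 1 / 2` (the scale is the diameter, so that an edge appears at its
length). -/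
def cech {E : Type u} [MetricSpace E] (c : NNReal) (S : Finset E) : Filtration E where
  toFun r :=
    { faces := {σ | σ.Nonempty ∧ σ ⊆ S ∧ ∃ z : E, ∀ x ∈ σ, dist x z ≤ c * r}
      isRelLowerSet_faces := fun _ hσ => ⟨hσ.1, fun _ hτ hne =>
        ⟨hne, hτ.trans hσ.2.1, hσ.2.2.imp fun _ hz x hx => hz x (hτ hx)⟩⟩ }
  monotone' _ _ h := fun _ hσ => ⟨hσ.1, hσ.2.1, hσ.2.2.imp fun _ hz x hx =>
    (hz x hx).trans (mul_le_mul_of_nonneg_left h c.coe_nonneg)⟩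

/-- `φ` restricted to `X` is an `ε`-quasi-isometry. -/
def IsQuasiIsometryOn {E F : Type*} [MetricSpace E] [MetricSpace F] (φ : E → F) (X : Set E)
    (ε : ℝ) : Prop :=
  ∀ x ∈ X, ∀ y ∈ X, |dist x y - dist (φ x) (φ y)| ≤ ε

end DistPers

end

/-! The 1-skeleton of a Rips or Čech filtration of `S` is a filtered complete graph: all vertices
enter at scale 0, and each edge enters at a fixed multiple `a` of its length. An entering edge
either merges two components, which ends a degree 0 class, or closes a cycle, which starts a degree
1 class that never dies because there are no triangles. The finite degree 0 deaths and the degree 1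
births together therefore list all edge weights, so the diagrams determine their sum
(`IsEdgeFiltration.totalWeight_eq`). Algebraically this is rank-nullity for the boundary map from
edges to vertices.

This sum is a 3-Lipschitz function of the diagrams for the Wasserstein distance
(`abs_totalWeight_sub_le`). Comparing `A` with `insert x A`, where `A` has `k - 1` points, bounds
the sum over `y ∈ A` of the distortions of the pairs `x, y`. An exchange and averaging argument
(`abs_le_of_abs_sum_le`) passes from these row sums to single entries, with `X'` as anchor. The
outcome is `36 ε₁ + ε₂`, well below the stated bound. -/

namespace DistPers

universe u v

/-! ### Lipschitz functionals on persistence diagrams -/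

section Matching

/-- A function on dots that is Lipschitz for the ground metric, also towards the diagonal,
sums up to a function on diagrams that is Lipschitz for the 1-Wasserstein distance. -/
theorem ofReal_abs_sum_sub_sum_le_wassersteinOne {f : Dot → ℝ}
    (hf : ∀ p q, ENNReal.ofReal |f p - f q| ≤ dotDist p q)
    (hf' : ∀ p, ENNReal.ofReal |f p| ≤ diagonalDist p) (A B : Multiset Dot) :
    ENNReal.ofReal |(A.map f).sum - (B.map f).sum| ≤ wassersteinOne A B := by
  have hdiag : ∀ C : Multiset Dot,
      ENNReal.ofReal |(C.map f).sum| ≤ (C.map diagonalDist).sum := by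
    intro C
    induction C using Multiset.induction_on with
    | empty => simp
    | cons p C ih =>
      simp only [Multiset.map_cons, Multiset.sum_cons]
      refine (ENNReal.ofReal_le_ofReal (abs_add_le _ _)).trans ?_
      rw [ENNReal.ofReal_add (abs_nonneg _) (abs_nonneg _)]
      exact add_le_add (hf' p) ih
  have hmatch : ∀ M : Multiset (Dot × Dot),
      ENNReal.ofReal |((M.map Prod.fst).map f).sum - ((M.map Prod.snd).map f).sum|
        ≤ (M.map fun q => dotDist q.1 q.2).sum := by
    intro M
    induction M using Multiset.induction_on with
    | empty => simp
    | cons p M ih =>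
      simp only [Multiset.map_cons, Multiset.sum_cons]
      rw [add_sub_add_comm]
      refine (ENNReal.ofReal_le_ofReal (abs_add_le _ _)).trans ?_
      rw [ENNReal.ofReal_add (abs_nonneg _) (abs_nonneg _)]
      exact add_le_add (hf _ _) ih
  unfold wassersteinOne
  refine le_iInf fun M => le_iInf fun A' => le_iInf fun B' => le_iInf fun hA => le_iInf fun hB => ?_
  subst hA hB
  simp only [Multiset.map_add, Multiset.sum_add]
  calc _ ≤ ENNReal.ofReal (|((M.map Prod.fst).map f).sum - ((M.map Prod.snd).map f).sum|
          + |(A'.map f).sum| + |(B'.map f).sum|) := by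
        refine ENNReal.ofReal_le_ofReal ?_
        rw [add_sub_add_comm]
        refine (abs_add_le _ _).trans ?_
        rw [add_assoc]
        exact add_le_add le_rfl (abs_sub _ _)
    _ ≤ _ := by
        rw [ENNReal.ofReal_add (by positivity) (abs_nonneg _),
          ENNReal.ofReal_add (abs_nonneg _) (abs_nonneg _)]
        exact add_le_add (add_le_add (hmatch M) (hdiag A')) (hdiag B')

/-- Half of the persistence of a dot, with value `0` at dots that never die. -/
noncomputable def halfPersistence : Dot → ℝ
  | (b, (d : ℝ)) => (d - b) / 2
  | (_, ⊤) => 0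

/-- The birth time of a dot that never dies, with value `0` at the other dots. -/
noncomputable def essentialBirth : Dot → ℝ
  | (_, (_ : ℝ)) => 0
  | (b, ⊤) => b

/-- Half the sum of the changes in birth and death is at most their maximum. The default value at
infinite dots is harmless, since a finite and an infinite dot are infinitely far apart. -/
theorem ofReal_abs_halfPersistence_sub_le (p q : Dot) :
    ENNReal.ofReal |halfPersistence p - halfPersistence q| ≤ dotDist p q := by
  obtain ⟨b, d⟩ := p
  obtain ⟨b', d'⟩ := q
  cases d with
  | top => cases d' with
    | top => simp [halfPersistence]
    | coe d' => simp [dotDist, deathDist]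
  | coe d => cases d' with
    | top => simp [dotDist, deathDist]
    | coe d' =>
      simp only [dotDist, deathDist, halfPersistence]
      rw [← ENNReal.ofReal_max]
      apply ENNReal.ofReal_le_ofReal
      grind

theorem ofReal_abs_halfPersistence_le (p : Dot) :
    ENNReal.ofReal |halfPersistence p| ≤ diagonalDist p := by
  obtain ⟨b, d⟩ := p
  cases d with
  | top => simp [diagonalDist]
  | coe d => simp [diagonalDist, halfPersistence, abs_div]

theorem ofReal_abs_essentialBirth_sub_le (p q : Dot) :
    ENNReal.ofReal |essentialBirth p - essentialBirth q| ≤ dotDist p q := by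
  obtain ⟨b, d⟩ := p
  obtain ⟨b', d'⟩ := q
  cases d with
  | top => cases d' with
    | top => simp [essentialBirth, dotDist]
    | coe d' => simp [dotDist, deathDist]
  | coe d => cases d' with
    | top => simp [dotDist, deathDist]
    | coe d' => simp [essentialBirth]

theorem ofReal_abs_essentialBirth_le (p : Dot) :
    ENNReal.ofReal |essentialBirth p| ≤ diagonalDist p := by
  obtain ⟨b, d⟩ := p
  cases d with
  | top => simp [diagonalDist]
  | coe d => simp [essentialBirth]

/-- The total persistence of the finite dots in degree `0` plus the total birth time of the
infinite dots in degree `1`. -/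
noncomputable def totalWeight (𝕜 : Type v) [Field 𝕜] {V : Type u} (K : Filtration V) : ℝ :=
  2 * ((diagram 𝕜 K 0).map halfPersistence).sum + ((diagram 𝕜 K 1).map essentialBirth).sum

/-- The constant is 2 + 1: degree 0 enters through twice a 1-Lipschitz functional, degree 1 through
a single one. -/
theorem abs_totalWeight_sub_le {𝕜 : Type*} [Field 𝕜] {V W : Type*} (K : Filtration V)
    (L : Filtration W) {ε : ℝ} (hε : 0 ≤ ε) (h : persistenceDist 𝕜 K L ≤ ENNReal.ofReal ε) :
    |totalWeight 𝕜 K - totalWeight 𝕜 L| ≤ 3 * ε := by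
  have h0 := (ENNReal.ofReal_le_ofReal_iff hε).1 <|
    ((ofReal_abs_sum_sub_sum_le_wassersteinOne ofReal_abs_halfPersistence_sub_le
      ofReal_abs_halfPersistence_le _ _).trans
      (le_iSup (fun n => wassersteinOne (diagram 𝕜 K n) (diagram 𝕜 L n)) 0)).trans h
  have h1 := (ENNReal.ofReal_le_ofReal_iff hε).1 <|
    ((ofReal_abs_sum_sub_sum_le_wassersteinOne ofReal_abs_essentialBirth_sub_le
      ofReal_abs_essentialBirth_le _ _).trans
      (le_iSup (fun n => wassersteinOne (diagram 𝕜 K n) (diagram 𝕜 L n)) 1)).trans h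
  unfold totalWeight
  rw [abs_le] at *
  constructor <;> linarith [h0.1, h0.2, h1.1, h1.2]

/-- A finite set covering the support is needed because `diagram` is a `finsum`, which would be 0 on
infinite support. -/
theorem sum_map_diagram {𝕜 : Type*} [Field 𝕜] {V : Type*} (K : Filtration V) (n : ℕ) (f : Dot → ℝ)
    (F : Finset Dot) (hF : ∀ p, dotMultiplicity 𝕜 K n p ≠ 0 → p ∈ F) :
    ((diagram 𝕜 K n).map f).sum = ∑ p ∈ F, (dotMultiplicity 𝕜 K n p : ℝ) * f p := by
  have h : diagram 𝕜 K n = ∑ p ∈ F, Multiset.replicate (dotMultiplicity 𝕜 K n p) p := by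
    refine finsum_eq_sum_of_support_subset _ fun p hp => hF p fun h0 => hp ?_
    simp [h0]
  rw [h, ← Multiset.coe_mapAddMonoidHom, map_sum, ← Multiset.coe_sumAddMonoidHom, map_sum]
  simp

end Matching

/-! ### Homology of graphs and rank-nullity -/

section Graph

variable {𝕜 : Type v} [Field 𝕜] {V : Type u}

theorem finrank_map_add_finrank_inf_ker {M N : Type*} [AddCommGroup M] [Module 𝕜 M]
    [AddCommGroup N] [Module 𝕜 N] (f : M →ₗ[𝕜] N) (p : Submodule 𝕜 M) [FiniteDimensional 𝕜 p] :
    Module.finrank 𝕜 (p.map f) + Module.finrank 𝕜 (p ⊓ LinearMap.ker f : Submodule 𝕜 M)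
      = Module.finrank 𝕜 p := by
  have h := (f.domRestrict p).finrank_range_add_finrank_ker
  rw [LinearMap.range_domRestrict, LinearMap.ker_domRestrict] at h
  rw [← h, ← Submodule.map_comap_subtype, Submodule.finrank_map_subtype_eq]

theorem finrank_supported {α : Type*} (F : Finset α) :
    Module.finrank 𝕜 (Finsupp.supported 𝕜 𝕜 (F : Set α)) = F.card := by
  rw [(Finsupp.supportedEquivFinsupp (F : Set α)).finrank_eq]
  simp

instance finiteDimensional_supported {α : Type*} (F : Finset α) :
    FiniteDimensional 𝕜 (Finsupp.supported 𝕜 𝕜 (F : Set α)) :=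
  Module.Finite.equiv (Finsupp.supportedEquivFinsupp (F : Set α)).symm

theorem mem_before {K : Filtration V} {r : ℝ} {σ : Finset V} :
    σ ∈ K.before r ↔ ∃ s < r, σ ∈ K s := by
  change σ ∈ ⋃ L ∈ _, PreAbstractSimplicialComplex.faces L ↔ _
  simp; rfl

theorem mem_total {K : Filtration V} {σ : Finset V} :
    σ ∈ K.total ↔ ∃ s, σ ∈ K s := by
  change σ ∈ ⋃ L ∈ _, PreAbstractSimplicialComplex.faces L ↔ _
  simp; rfl

theorem boundary_single (σ : Finset V) (a : 𝕜) :
    boundary 𝕜 V (Finsupp.single σ a) = a • simplexBoundary 𝕜 σ := by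
  simp [boundary]

theorem simplexBoundary_eq_zero_of_card_eq_one {σ : Finset V} (h : σ.card = 1) :
    simplexBoundary 𝕜 σ = 0 := by
  obtain ⟨v, rfl⟩ := Finset.card_eq_one.1 h
  simp [simplexBoundary]

theorem cycles_zero (K : PreAbstractSimplicialComplex V) : cycles 𝕜 0 K = chains 𝕜 0 K := by
  refine inf_eq_left.2 ?_
  rw [chains, Finsupp.supported_eq_span_single, Submodule.span_le]
  rintro _ ⟨σ, hσ, rfl⟩
  simp [boundary_single, simplexBoundary_eq_zero_of_card_eq_one (𝕜 := 𝕜) hσ.2]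

theorem boundaries_le_chains (n : ℕ) (K : PreAbstractSimplicialComplex V) :
    boundaries 𝕜 n K ≤ chains 𝕜 n K := by
  classical
  rw [boundaries, chains, Finsupp.supported_eq_span_single, Submodule.map_span, Submodule.span_le]
  rintro _ ⟨_, ⟨σ, hσ, rfl⟩, rfl⟩
  rw [boundary_single, one_smul, simplexBoundary]
  refine Submodule.sum_mem _ fun x hx => ?_
  split_ifs with hne
  · refine Finsupp.single_mem_supported 𝕜 _ ⟨?_, ?_⟩
    · exact (K.isRelLowerSet_faces hσ.1).2 (Finset.erase_subset _ _) (by convert hne)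
    · have := Finset.card_erase_of_mem hx
      have h2 : σ.card = n + 1 + 1 := hσ.2
      rw [h2, Nat.add_sub_cancel] at this
      convert this
  · exact Submodule.zero_mem _

theorem chains_congr {n : ℕ} {K L : PreAbstractSimplicialComplex V}
    (h : ∀ σ : Finset V, σ.card = n + 1 → (σ ∈ K ↔ σ ∈ L)) : chains 𝕜 n K = chains 𝕜 n L := by
  have : {σ | σ ∈ K ∧ σ.card = n + 1} = {σ | σ ∈ L ∧ σ.card = n + 1} :=
    Set.ext fun σ => and_congr_left (h σ)
  rw [chains, chains, this]

theorem chains_eq_supported {n : ℕ} {K : PreAbstractSimplicialComplex V} {F : Finset (Finset V)}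
    (h : ∀ σ, σ ∈ F ↔ σ ∈ K ∧ σ.card = n + 1) :
    chains 𝕜 n K = Finsupp.supported 𝕜 𝕜 (F : Set (Finset V)) := by
  have : {σ | σ ∈ K ∧ σ.card = n + 1} = (F : Set (Finset V)) := Set.ext fun σ => (h σ).symm
  rw [chains, this]

/-- Over a complex without triangles, no class of degree `1` dies. -/
theorem persistentBetti_one {K L : PreAbstractSimplicialComplex V} (hL : ∀ σ ∈ L, σ.card ≤ 2) :
    persistentBetti 𝕜 1 K L = Module.finrank 𝕜 (cycles 𝕜 1 K) := by
  have h : boundaries 𝕜 1 L = ⊥ := by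
    have : {σ | σ ∈ L ∧ σ.card = 1 + 1 + 1} = ∅ := by
      ext σ
      simp only [Set.mem_ofPred_eq, Set.mem_empty_iff_false, iff_false, not_and]
      intro h1 h2
      have := hL σ h1
      omega
    rw [boundaries, chains, this, Finsupp.supported_empty, Submodule.map_bot]
  rw [persistentBetti]
  refine (LinearEquiv.finrank_eq (Submodule.equivMapOfInjective _ ?_ _)).symm
  rw [← LinearMap.ker_eq_bot, Submodule.ker_mkQ, h]

/-- All 0-chains are cycles, and both complexes have the vertex set `S`, so the image is the full
chain space modulo the boundaries of `L`. -/
theorem persistentBetti_zero {K L : PreAbstractSimplicialComplex V} {S : Finset V}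
    (hK : ∀ v, {v} ∈ K ↔ v ∈ S) (hL : ∀ v, {v} ∈ L ↔ v ∈ S) :
    persistentBetti 𝕜 0 K L + Module.finrank 𝕜 (boundaries 𝕜 0 L) = S.card := by
  classical
  have key : ∀ {K : PreAbstractSimplicialComplex V}, (∀ v, {v} ∈ K ↔ v ∈ S) →
      chains 𝕜 0 K = Finsupp.supported 𝕜 𝕜 ((S.powersetCard 1 : Finset (Finset V)) : Set _) := by
    intro K hK
    refine chains_eq_supported fun σ => ?_
    simp only [Finset.mem_powersetCard, Finset.card_eq_one, zero_add]
    constructor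
    · rintro ⟨h, v, rfl⟩
      exact ⟨(hK v).2 (by simpa using h), v, rfl⟩
    · rintro ⟨h, v, rfl⟩
      exact ⟨by simpa using (hK v).1 h, v, rfl⟩
  have h := boundaries_le_chains (𝕜 := 𝕜) 0 L
  rw [key hL, ← key hK] at h
  have hc : Module.finrank 𝕜 (chains 𝕜 0 K) = S.card := by
    rw [key hK, finrank_supported]; simp
  have : FiniteDimensional 𝕜 (chains 𝕜 0 K) := by rw [key hK]; infer_instance
  have := finrank_map_add_finrank_inf_ker (boundaries 𝕜 0 L).mkQ (chains 𝕜 0 K)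
  rw [Submodule.ker_mkQ, inf_eq_right.2 h, hc] at this
  rw [persistentBetti, cycles_zero, this]

theorem persistentBetti_zero_of_no_vertices {K L : PreAbstractSimplicialComplex V}
    (hK : ∀ v, {v} ∉ K) : persistentBetti 𝕜 0 K L = 0 := by
  have : {σ | σ ∈ K ∧ σ.card = 0 + 1} = ∅ := by
    ext σ
    simp only [zero_add, Finset.card_eq_one, Set.mem_ofPred_eq, Set.mem_empty_iff_false, iff_false]
    rintro ⟨h, v, rfl⟩
    exact hK v h
  rw [persistentBetti, cycles_zero, chains, this, Finsupp.supported_empty, Submodule.map_bot]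
  simp

/-- Rank-nullity for the boundary operator of a graph. -/
theorem finrank_boundaries_zero_add_finrank_cycles_one {K : PreAbstractSimplicialComplex V}
    {F : Finset (Finset V)} (h : ∀ σ, σ ∈ F ↔ σ ∈ K ∧ σ.card = 2) :
    Module.finrank 𝕜 (boundaries 𝕜 0 K) + Module.finrank 𝕜 (cycles 𝕜 1 K) = F.card := by
  have hF := chains_eq_supported (𝕜 := 𝕜) (n := 1) h
  have : FiniteDimensional 𝕜 (chains 𝕜 1 K) := by rw [hF]; infer_instance
  rw [boundaries, cycles, zero_add, finrank_map_add_finrank_inf_ker, hF, finrank_supported]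

/-- The finite edge set `F` ensures finite dimension, without which `finrank` could be 0 on the
larger space. Monotonicity later lets truncated differences of ranks be cast to `ℝ`. -/
theorem finrank_boundaries_mono {K L : PreAbstractSimplicialComplex V} (hKL : K ≤ L)
    {F : Finset (Finset V)} (h : ∀ σ, σ ∈ F ↔ σ ∈ L ∧ σ.card = 2) :
    Module.finrank 𝕜 (boundaries 𝕜 0 K) ≤ Module.finrank 𝕜 (boundaries 𝕜 0 L) := by
  have hF := chains_eq_supported (𝕜 := 𝕜) (n := 1) h
  have : FiniteDimensional 𝕜 (chains 𝕜 1 L) := by rw [hF]; infer_instance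
  have : FiniteDimensional 𝕜 (boundaries 𝕜 0 L) := by rw [boundaries, zero_add]; infer_instance
  refine Submodule.finrank_mono (Submodule.map_mono (Finsupp.supported_mono ?_))
  exact fun σ hσ => ⟨hKL hσ.1, hσ.2⟩

theorem finrank_cycles_mono {K L : PreAbstractSimplicialComplex V} (hKL : K ≤ L)
    {F : Finset (Finset V)} (h : ∀ σ, σ ∈ F ↔ σ ∈ L ∧ σ.card = 2) :
    Module.finrank 𝕜 (cycles 𝕜 1 K) ≤ Module.finrank 𝕜 (cycles 𝕜 1 L) := by
  have hF := chains_eq_supported (𝕜 := 𝕜) (n := 1) h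
  have : FiniteDimensional 𝕜 (chains 𝕜 1 L) := by rw [hF]; infer_instance
  have : FiniteDimensional 𝕜 (cycles 𝕜 1 L) := by rw [cycles]; infer_instance
  refine Submodule.finrank_mono (inf_le_inf_right _ (Finsupp.supported_mono ?_))
  exact fun σ hσ => ⟨hKL hσ.1, hσ.2⟩

end Graph
-- Diagrams of filtered complete graphs
section EdgeFiltration

variable {V : Type u}

/-- `K` is the filtration of the complete graph on `S` in which the vertices appear at `0` and
each edge `σ` appears at scale `ℓ σ > 0`. -/
structure IsEdgeFiltration (K : Filtration V) (S : Finset V) (ℓ : Finset V → ℝ) : Prop where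
  mem_iff : ∀ r σ, σ ∈ K r ↔ σ.Nonempty ∧ σ ⊆ S ∧ σ.card ≤ 2 ∧ ℓ σ ≤ r
  vertex : ∀ v, ℓ {v} = 0
  edge_pos : ∀ σ ∈ S.powersetCard 2, 0 < ℓ σ

namespace IsEdgeFiltration

variable {K : Filtration V} {S : Finset V} {ℓ : Finset V → ℝ}

theorem mem_before_iff (hK : IsEdgeFiltration K S ℓ) (r : ℝ) (σ : Finset V) :
    σ ∈ K.before r ↔ σ.Nonempty ∧ σ ⊆ S ∧ σ.card ≤ 2 ∧ ℓ σ < r := by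
  simp only [mem_before, hK.mem_iff]
  constructor
  · rintro ⟨s, hs, h1, h2, h3, h4⟩
    exact ⟨h1, h2, h3, h4.trans_lt hs⟩
  · rintro ⟨h1, h2, h3, h4⟩
    exact ⟨ℓ σ, h4, h1, h2, h3, le_rfl⟩

theorem mem_total_iff (hK : IsEdgeFiltration K S ℓ) (σ : Finset V) :
    σ ∈ K.total ↔ σ.Nonempty ∧ σ ⊆ S ∧ σ.card ≤ 2 := by
  simp only [mem_total, hK.mem_iff]
  constructor
  · rintro ⟨s, h1, h2, h3, -⟩
    exact ⟨h1, h2, h3⟩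
  · rintro ⟨h1, h2, h3⟩
    exact ⟨ℓ σ, h1, h2, h3, le_rfl⟩

theorem vertex_mem_iff (hK : IsEdgeFiltration K S ℓ) {r : ℝ} (hr : 0 ≤ r) (v : V) :
    {v} ∈ K r ↔ v ∈ S := by
  simp [hK.mem_iff, hK.vertex, hr]

theorem vertex_mem_before_iff (hK : IsEdgeFiltration K S ℓ) {r : ℝ} (hr : 0 < r) (v : V) :
    {v} ∈ K.before r ↔ v ∈ S := by
  simp [hK.mem_before_iff, hK.vertex, hr]

theorem vertex_notMem_before (hK : IsEdgeFiltration K S ℓ) {r : ℝ} (hr : r ≤ 0) (v : V) :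
    {v} ∉ K.before r := by
  simp [hK.mem_before_iff, hK.vertex, hr]

theorem vertex_mem_before_iff_of_ne (hK : IsEdgeFiltration K S ℓ) {r : ℝ} (hr : r ≠ 0) (v : V) :
    {v} ∈ K r ↔ {v} ∈ K.before r := by
  simp [hK.mem_before_iff, hK.mem_iff, hK.vertex, hr.symm.le_iff_lt]

open Classical in
theorem mem_edges_iff (hK : IsEdgeFiltration K S ℓ) (r : ℝ) (σ : Finset V) :
    σ ∈ (S.powersetCard 2).filter (ℓ · ≤ r) ↔ σ ∈ K r ∧ σ.card = 2 := by
  rw [Finset.mem_filter, Finset.mem_powersetCard, hK.mem_iff]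
  constructor
  · rintro ⟨⟨h1, h2⟩, h3⟩
    exact ⟨⟨Finset.card_pos.1 (by omega), h1, h2.le, h3⟩, h2⟩
  · rintro ⟨⟨-, h1, -, h3⟩, h2⟩
    exact ⟨⟨h1, h2⟩, h3⟩

open Classical in
theorem mem_edges_before_iff (hK : IsEdgeFiltration K S ℓ) (r : ℝ) (σ : Finset V) :
    σ ∈ (S.powersetCard 2).filter (ℓ · < r) ↔ σ ∈ K.before r ∧ σ.card = 2 := by
  rw [Finset.mem_filter, Finset.mem_powersetCard, hK.mem_before_iff]
  constructor
  · rintro ⟨⟨h1, h2⟩, h3⟩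
    exact ⟨⟨Finset.card_pos.1 (by omega), h1, h2.le, h3⟩, h2⟩
  · rintro ⟨⟨-, h1, -, h3⟩, h2⟩
    exact ⟨⟨h1, h2⟩, h3⟩

open Classical in
theorem chains_one_eq_before (𝕜 : Type v) [Field 𝕜] (hK : IsEdgeFiltration K S ℓ) {r : ℝ}
    (hr : r ∉ (S.powersetCard 2).image ℓ) : chains 𝕜 1 (K r) = chains 𝕜 1 (K.before r) := by
  refine chains_congr fun σ hσ => ?_
  rw [hK.mem_iff, hK.mem_before_iff]
  refine and_congr_right fun _ => and_congr_right fun h2 => and_congr_right fun _ => ?_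
  refine Ne.le_iff_lt fun h => hr ?_
  exact Finset.mem_image.2 ⟨σ, Finset.mem_powersetCard.2 ⟨h2, hσ⟩, h⟩

theorem before_le (K : Filtration V) (r : ℝ) : K.before r ≤ K r :=
  iSup_le fun s => K.monotone s.2.le

variable (𝕜 : Type v) [Field 𝕜]

theorem dotMultiplicity_zero_of_ne (hK : IsEdgeFiltration K S ℓ) {b : ℝ} (hb : b ≠ 0)
    (d : WithTop ℝ) : dotMultiplicity 𝕜 K 0 (b, d) = 0 := by
  have h : ∀ L, persistentBetti 𝕜 0 (K b) L = persistentBetti 𝕜 0 (K.before b) L := by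
    intro L
    have : chains 𝕜 0 (K b) = chains 𝕜 0 (K.before b) := by
      refine chains_congr fun σ hσ => ?_
      obtain ⟨v, rfl⟩ := Finset.card_eq_one.1 hσ
      exact hK.vertex_mem_before_iff_of_ne hb v
    rw [persistentBetti, persistentBetti, cycles_zero, cycles_zero, this]
  cases d with
  | top => simp [dotMultiplicity, h]
  | coe d => simp [dotMultiplicity, h]

/-- Before scale 0 there are no vertices, so two of the four persistent Betti numbers vanish; in the
other two the vertex count cancels. -/
theorem dotMultiplicity_zero (hK : IsEdgeFiltration K S ℓ) {d : ℝ} (hd : 0 < d) :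
    dotMultiplicity 𝕜 K 0 (0, (d : WithTop ℝ)) =
      Module.finrank 𝕜 (boundaries 𝕜 0 (K d)) - Module.finrank 𝕜 (boundaries 𝕜 0 (K.before d)) := by
  have h1 := persistentBetti_zero (𝕜 := 𝕜) (hK.vertex_mem_iff le_rfl)
    (hK.vertex_mem_before_iff hd)
  have h2 := persistentBetti_zero (𝕜 := 𝕜) (hK.vertex_mem_iff le_rfl)
    (hK.vertex_mem_iff hd.le)
  simp only [dotMultiplicity, hd, if_true,
    persistentBetti_zero_of_no_vertices (𝕜 := 𝕜) (hK.vertex_notMem_before le_rfl)]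
  omega

theorem dotMultiplicity_one (hK : IsEdgeFiltration K S ℓ) (b : ℝ) :
    dotMultiplicity 𝕜 K 1 (b, ⊤) =
      Module.finrank 𝕜 (cycles 𝕜 1 (K b)) - Module.finrank 𝕜 (cycles 𝕜 1 (K.before b)) := by
  have h : ∀ σ ∈ K.total, σ.card ≤ 2 := fun σ hσ => ((hK.mem_total_iff σ).1 hσ).2.2
  simp only [dotMultiplicity, persistentBetti_one h]
  omega

theorem dotMultiplicity_one_coe (hK : IsEdgeFiltration K S ℓ) (b d : ℝ) :
    dotMultiplicity 𝕜 K 1 (b, (d : WithTop ℝ)) = 0 := by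
  have h : ∀ σ ∈ K d, σ.card ≤ 2 := fun σ hσ => ((hK.mem_iff d σ).1 hσ).2.2.1
  have h' : ∀ σ ∈ K.before d, σ.card ≤ 2 := fun σ hσ => ((hK.mem_before_iff d σ).1 hσ).2.2.1
  simp [dotMultiplicity, persistentBetti_one h, persistentBetti_one h']

-- Degree 0 classes are born at 0, so twice the half persistence is the death time. Deaths at `d`
-- are counted by the jump of the boundary rank there.
open Classical in
theorem sum_halfPersistence (hK : IsEdgeFiltration K S ℓ) :
    2 * ((diagram 𝕜 K 0).map halfPersistence).sum = ∑ d ∈ (S.powersetCard 2).image ℓ,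
      ((Module.finrank 𝕜 (boundaries 𝕜 0 (K d)) : ℝ)
        - Module.finrank 𝕜 (boundaries 𝕜 0 (K.before d))) * d := by
  -- The dots at `⊤` belong to the support but contribute 0.
  rw [sum_map_diagram K 0 halfPersistence
    ({0} ×ˢ insert ⊤ (((S.powersetCard 2).image ℓ).image ((↑) : ℝ → WithTop ℝ)))]
  · rw [Finset.sum_product, Finset.sum_singleton, Finset.sum_insert (by simp),
      Finset.sum_image (fun _ _ _ _ h => WithTop.coe_injective h)]
    simp only [halfPersistence, mul_zero, zero_add, sub_zero, Finset.mul_sum]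
    refine Finset.sum_congr rfl fun d hd => ?_
    obtain ⟨σ, hσ, rfl⟩ := Finset.mem_image.1 hd
    rw [hK.dotMultiplicity_zero 𝕜 (hK.edge_pos σ hσ), Nat.cast_sub]
    · ring
    · exact finrank_boundaries_mono (before_le K _) (hK.mem_edges_iff _)
  · rintro ⟨b, d⟩ h
    have hb : b = 0 := by
      by_contra hb
      exact h (hK.dotMultiplicity_zero_of_ne 𝕜 hb d)
    subst hb
    cases d with
    | top => simp
    | coe d =>
      have hd : 0 < d := by
        by_contra hd
        simp [dotMultiplicity, hd] at h
      suffices d ∈ (S.powersetCard 2).image ℓ from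
        Finset.mk_mem_product (Finset.mem_singleton_self _)
          (Finset.mem_insert_of_mem (Finset.mem_image_of_mem _ this))
      by_contra hd'
      refine h ?_
      rw [hK.dotMultiplicity_zero 𝕜 hd, boundaries, boundaries, zero_add,
        hK.chains_one_eq_before 𝕜 hd', Nat.sub_self]

open Classical in
theorem sum_essentialBirth (hK : IsEdgeFiltration K S ℓ) :
    ((diagram 𝕜 K 1).map essentialBirth).sum = ∑ b ∈ (S.powersetCard 2).image ℓ,
      ((Module.finrank 𝕜 (cycles 𝕜 1 (K b)) : ℝ)
        - Module.finrank 𝕜 (cycles 𝕜 1 (K.before b))) * b := by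
  rw [sum_map_diagram K 1 essentialBirth (((S.powersetCard 2).image ℓ) ×ˢ {⊤})]
  · rw [Finset.sum_product]
    refine Finset.sum_congr rfl fun b _ => ?_
    rw [Finset.sum_singleton, hK.dotMultiplicity_one 𝕜, Nat.cast_sub]
    · rfl
    · exact finrank_cycles_mono (before_le K b) (hK.mem_edges_iff b)
  · rintro ⟨b, d⟩ h
    cases d with
    | coe d => exact absurd (hK.dotMultiplicity_one_coe 𝕜 b d) h
    | top =>
      suffices b ∈ (S.powersetCard 2).image ℓ from
        Finset.mk_mem_product this (Finset.mem_singleton_self _)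
      by_contra hb
      refine h ?_
      rw [hK.dotMultiplicity_one 𝕜, cycles, cycles, hK.chains_one_eq_before 𝕜 hb, Nat.sub_self]

/-- The diagrams of a filtered complete graph determine the sum of its edge weights. -/
theorem totalWeight_eq (hK : IsEdgeFiltration K S ℓ) :
    totalWeight 𝕜 K = ∑ σ ∈ S.powersetCard 2, ℓ σ := by
  classical
  rw [totalWeight, hK.sum_halfPersistence 𝕜, hK.sum_essentialBirth 𝕜, ← Finset.sum_add_distrib,
    ← Finset.sum_fiberwise_of_maps_to (fun σ hσ => Finset.mem_image_of_mem ℓ hσ)]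
  refine Finset.sum_congr rfl fun r _ => ?_
  -- Rank-nullity at `r` and just before `r`: the jumps of the boundary rank and of the cycle rank
  -- add up to the number of edges of weight exactly `r`.
  have h1 := finrank_boundaries_zero_add_finrank_cycles_one (𝕜 := 𝕜) (hK.mem_edges_iff r)
  have h2 := finrank_boundaries_zero_add_finrank_cycles_one (𝕜 := 𝕜) (hK.mem_edges_before_iff r)
  have h3 : ((S.powersetCard 2).filter (ℓ · ≤ r)).card
      = ((S.powersetCard 2).filter (ℓ · < r)).card
        + ((S.powersetCard 2).filter (ℓ · = r)).card := by
    rw [← Finset.card_union_of_disjoint, ← Finset.filter_or]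
    · simp only [le_iff_lt_or_eq]
    · exact Finset.disjoint_filter.2 fun _ _ h h' => h.ne h'
  rw [Finset.sum_congr rfl (fun σ hσ => (Finset.mem_filter.1 hσ).2), Finset.sum_const,
    nsmul_eq_mul]
  have h4 := congrArg (Nat.cast (R := ℝ)) h1
  have h5 := congrArg (Nat.cast (R := ℝ)) h2
  have h6 := congrArg (Nat.cast (R := ℝ)) h3
  push_cast at h4 h5 h6
  linear_combination r * (h4 - h5 + h6)

end IsEdgeFiltration

end EdgeFiltration

/-! ### Edge weights from distances, and recovery of single distances -/

section Metric

/-- The length of the edge `σ`, scaled by `a`. -/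
noncomputable def edgeLength {E : Type*} [MetricSpace E] (a : ℝ) (σ : Finset E) : ℝ :=
  a / 2 * ∑ x ∈ σ, ∑ y ∈ σ, dist x y

variable {E : Type*} [MetricSpace E]

theorem edgeLength_singleton (a : ℝ) (x : E) : edgeLength a {x} = 0 := by
  simp [edgeLength]

theorem edgeLength_pair [DecidableEq E] (a : ℝ) {x y : E} (h : x ≠ y) :
    edgeLength a {x, y} = a * dist x y := by
  simp only [edgeLength, Finset.sum_pair h, dist_self, dist_comm y x]
  ring

theorem edgeLength_pos {a : ℝ} (ha : 0 < a) {S : Finset E} :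
    ∀ σ ∈ S.powersetCard 2, 0 < edgeLength a σ := by
  classical
  intro σ hσ
  obtain ⟨x, y, hxy, rfl⟩ := Finset.card_eq_two.1 (Finset.mem_powersetCard.1 hσ).2
  rw [edgeLength_pair a hxy]
  exact mul_pos ha (dist_pos.2 hxy)

/-- A filtration of `1`-skeleta is an edge filtration once its vertices and edges are right. -/
theorem isEdgeFiltration_skeleton {K : Filtration E} {S : Finset E} {a : ℝ} (ha : 0 < a)
    (hS : ∀ r, ∀ σ ∈ K r, σ.Nonempty ∧ σ ⊆ S)
    (hvertex : ∀ r, ∀ x ∈ S, {x} ∈ K r ↔ 0 ≤ r)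
    -- Describing the pair by membership avoids decidable equality on `E`.
    (hedge : ∀ r (x y : E) (σ : Finset E), σ ⊆ S → x ≠ y → (∀ z, z ∈ σ ↔ z = x ∨ z = y) →
      (σ ∈ K r ↔ a * dist x y ≤ r)) :
    IsEdgeFiltration (skeleton 1 K) S (edgeLength a) where
  mem_iff r σ := by
    classical
    change σ ∈ K r ∧ σ.card ≤ 1 + 1 ↔ _
    suffices σ.Nonempty → σ ⊆ S → σ.card ≤ 2 → (σ ∈ K r ↔ edgeLength a σ ≤ r) by
      constructor
      · rintro ⟨h, hc⟩
        obtain ⟨h1, h2⟩ := hS r σ h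
        exact ⟨h1, h2, hc, (this h1 h2 hc).1 h⟩
      · rintro ⟨h1, h2, hc, h⟩
        exact ⟨(this h1 h2 hc).2 h, hc⟩
    intro h1 h2 hc
    rcases (Nat.le_succ_iff.1 hc) with hc | hc
    · obtain ⟨x, rfl⟩ := Finset.card_eq_one.1 (le_antisymm hc h1.card_pos)
      rw [edgeLength_singleton, hvertex r x (by simpa using h2)]
    · obtain ⟨x, y, hxy, rfl⟩ := Finset.card_eq_two.1 hc
      rw [edgeLength_pair a hxy, hedge r x y _ h2 hxy (by simp)]
  vertex := edgeLength_singleton a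
  edge_pos := edgeLength_pos ha

theorem isEdgeFiltration_rips (S : Finset E) :
    IsEdgeFiltration (skeleton 1 (rips S)) S (edgeLength 1) := by
  have hmem : ∀ r (σ : Finset E), σ ∈ rips S r ↔
    σ.Nonempty ∧ σ ⊆ S ∧ ∀ x ∈ σ, ∀ y ∈ σ, dist x y ≤ r := fun _ _ => Iff.rfl
  refine isEdgeFiltration_skeleton one_pos (fun r σ h => ⟨h.1, h.2.1⟩) ?_ ?_
  · intro r x hx
    simp [hmem, hx]
  · intro r x y σ hσ hxy h
    rw [hmem, one_mul]
    constructor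
    · rintro ⟨-, -, h3⟩
      exact h3 x ((h x).2 (.inl rfl)) y ((h y).2 (.inr rfl))
    · intro hr
      refine ⟨⟨x, (h x).2 (.inl rfl)⟩, hσ, fun u hu w hw => ?_⟩
      have h0 : 0 ≤ r := dist_nonneg.trans hr
      rcases (h u).1 hu with rfl | rfl <;> rcases (h w).1 hw with rfl | rfl
      · simpa using h0
      · exact hr
      · rwa [dist_comm]
      · simpa using h0

/-- Two balls of radius `c * r` meet exactly when their centres are at most `2 * c * r` apart. The
midpoint gives the common point; this is where the normed space structure is used. -/
theorem isEdgeFiltration_cech {E : Type*} [NormedAddCommGroup E] [NormedSpace ℝ E] {c : NNReal}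
    (hc : 0 < c) (S : Finset E) :
    IsEdgeFiltration (skeleton 1 (cech c S)) S (edgeLength (1 / (2 * c))) := by
  have hmem : ∀ r (σ : Finset E), σ ∈ cech c S r ↔
    σ.Nonempty ∧ σ ⊆ S ∧ ∃ z : E, ∀ x ∈ σ, dist x z ≤ c * r := fun _ _ => Iff.rfl
  have hc' : (0 : ℝ) < c := hc
  refine isEdgeFiltration_skeleton (by positivity) (fun r σ h => ⟨h.1, h.2.1⟩) ?_ ?_
  · intro r x hx
    simp only [hmem, Finset.singleton_nonempty, Finset.singleton_subset_iff, hx, true_and,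
      Finset.mem_singleton, forall_eq]
    constructor
    · rintro ⟨z, hz⟩
      exact nonneg_of_mul_nonneg_right (dist_nonneg.trans hz) hc'
    · exact fun hr => ⟨x, by rw [dist_self]; positivity⟩
  · intro r x y σ hσ hxy h
    rw [hmem, one_div, inv_mul_le_iff₀ (by positivity)]
    constructor
    · rintro ⟨-, -, z, hz⟩
      have h1 := hz x ((h x).2 (.inl rfl))
      have h2 := hz y ((h y).2 (.inr rfl))
      linarith [dist_triangle_right x y z]
    · intro hr
      refine ⟨⟨x, (h x).2 (.inl rfl)⟩, hσ, midpoint ℝ x y, fun u hu => ?_⟩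
      rcases (h u).1 hu with rfl | rfl
      · rw [dist_left_midpoint, Real.norm_ofNat]
        linarith
      · rw [dist_right_midpoint, Real.norm_ofNat]
        linarith

theorem sum_edgeLength_insert [DecidableEq E] (a : ℝ) {x : E} {A : Finset E} (hx : x ∉ A) :
    ∑ σ ∈ (insert x A).powersetCard 2, edgeLength a σ
      = ∑ σ ∈ A.powersetCard 2, edgeLength a σ + a * ∑ y ∈ A, dist x y := by
  rw [Finset.powersetCard_succ_insert hx, Finset.sum_union, Finset.powersetCard_one,
    Finset.map_eq_image, Finset.image_image, Finset.sum_image, Finset.mul_sum]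
  · congr 1
    refine Finset.sum_congr rfl fun y hy => ?_
    exact edgeLength_pair a (fun h => hx (h ▸ hy))
  · intro y hy z hz h
    have hy' : y ∈ insert x ({z} : Finset E) := by
      rw [← show insert x ({y} : Finset E) = insert x ({z} : Finset E) from h]; simp
    rcases Finset.mem_insert.1 hy' with rfl | h'
    · exact absurd hy hx
    · exact Finset.mem_singleton.1 h'
  · rw [Finset.disjoint_left]
    intro σ hσ hσ'
    obtain ⟨τ, -, rfl⟩ := Finset.mem_image.1 hσ'
    exact hx ((Finset.mem_powersetCard.1 hσ).1 (Finset.mem_insert_self _ _))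

/-- If all partial row sums of `k - 1` entries of a symmetric array are small, and its entries on
some set of `k - 1` points are small, then so are all its entries. -/
theorem abs_le_of_abs_sum_le {E : Type*} {X : Set E} {Δ : E → E → ℝ}
    (hsymm : ∀ x y, Δ x y = Δ y x) (hself : ∀ x, Δ x x = 0) {k : ℕ} (hk : 1 < k) {η ε : ℝ}
    (hη : ∀ A : Finset E, (A : Set E) ⊆ X → A.card = k - 1 → ∀ x ∈ X, x ∉ A →
      |∑ y ∈ A, Δ x y| ≤ η)
    {X' : Finset E} (hX' : (X' : Set E) ⊆ X) (hcard : X'.card = k - 1)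
    (hε : ∑ p ∈ X' ×ˢ X', |Δ p.1 p.2| ≤ ε) {x y : E} (hx : x ∈ X) (hy : y ∈ X) (hη0 : 0 ≤ η) :
    |Δ x y| ≤ 3 * η + ε := by
  classical
  rw [Finset.sum_product] at hε
  have hε0 : 0 ≤ ε :=
    (Finset.sum_nonneg fun _ _ => Finset.sum_nonneg fun _ _ => abs_nonneg _).trans hε
  have hrow : ∀ u ∈ X', ∑ w ∈ X', |Δ u w| ≤ ε := fun u hu => (Finset.single_le_sum
    (f := fun u => ∑ w ∈ X', |Δ u w|)
    (fun _ _ => Finset.sum_nonneg fun _ _ => abs_nonneg _) hu).trans hε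
  -- Exchange `w` for `u` in `X'`: the row sum of `w` over the new set is `Δ w u` plus a row sum
  -- within `X'`, which is at most `ε` in absolute value.
  have hmixed : ∀ u ∈ X, u ∉ X' → ∀ w ∈ X', |Δ w u| ≤ η + ε := by
    intro u hu huX' w hw
    have hwu : w ≠ u := fun h => huX' (h ▸ hw)
    have hu' : u ∉ X'.erase w := fun h => huX' (Finset.mem_of_mem_erase h)
    have h := hη (insert u (X'.erase w)) ?_ ?_ w (hX' hw) ?_
    · rw [Finset.sum_insert hu', Finset.sum_erase _ (hself w)] at h
      have h1 := (Finset.abs_sum_le_sum_abs (fun z => Δ w z) X').trans (hrow w hw)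
      have h2 := abs_sub (Δ w u + ∑ z ∈ X', Δ w z) (∑ z ∈ X', Δ w z)
      rw [add_sub_cancel_right] at h2
      linarith
    · rw [Finset.coe_insert, Set.insert_subset_iff]
      exact ⟨hu, fun z hz => hX' (Finset.mem_of_mem_erase hz)⟩
    · rw [Finset.card_insert_of_notMem hu', Finset.card_erase_of_mem hw]
      omega
    · simp [hwu]
  by_cases hxX : x ∈ X' <;> by_cases hyX : y ∈ X'
  · have := (Finset.single_le_sum (f := fun w => |Δ x w|) (fun _ _ => abs_nonneg _) hyX).trans
      (hrow x hxX)
    linarith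
  · linarith [hmixed y hy hyX x hxX]
  · rw [hsymm]
    linarith [hmixed x hx hxX y hyX]
  · rcases eq_or_ne x y with rfl | hxy
    · rw [hself, abs_zero]
      linarith
    -- Both points lie outside `X'`. Deleting any one point of the `k`-point set `B` leaves an
    -- admissible set for the row of `x`.
    set B := insert y X' with hB
    have hBc : B.card = k := by
      rw [hB, Finset.card_insert_of_notMem hyX]
      omega
    have hxB : x ∉ B := by simp [hB, hxy, hxX]
    have hBX : (B : Set E) ⊆ X := by
      rw [hB, Finset.coe_insert, Set.insert_subset_iff]
      exact ⟨hy, hX'⟩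
    set s := ∑ w ∈ B, Δ x w with hs
    have hz : ∀ z ∈ B, |s - Δ x z| ≤ η := by
      intro z hz
      rw [hs, ← Finset.sum_erase_eq_sub hz]
      refine hη _ (fun w hw => hBX (Finset.mem_of_mem_erase hw)) ?_ x hx
        (fun h => hxB (Finset.mem_of_mem_erase h))
      rw [Finset.card_erase_of_mem hz, hBc]
    -- Add up the bounds over all deleted points: each entry of the row survives `k - 1` times.
    have hsum : |(k : ℝ) * s - s| ≤ k * η := by
      have h1 : (k : ℝ) * s - s = ∑ z ∈ B, (s - Δ x z) := by
        rw [Finset.sum_sub_distrib, Finset.sum_const, hBc, nsmul_eq_mul]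
      rw [h1]
      refine (Finset.abs_sum_le_sum_abs _ _).trans ((Finset.sum_le_sum hz).trans ?_)
      rw [Finset.sum_const, hBc, nsmul_eq_mul]
    have hk2 : (2 : ℝ) ≤ k := by exact_mod_cast hk
    -- Here `k / (k - 1) ≤ 2`, since `k ≥ 2`.
    have hs2 : |s| ≤ 2 * η := by
      have h1 : (k : ℝ) * s - s = (k - 1) * s := by ring
      rw [h1, abs_mul, abs_of_nonneg (by linarith)] at hsum
      nlinarith
    have h1 := hz y (Finset.mem_insert_self _ _)
    have h2 := abs_sub s (s - Δ x y)
    rw [sub_sub_cancel] at h2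
    linarith

/-- Bijections that roughly preserve the diagrams of edge filtrations of all sets with `k` and
`k - 1` points are quasi-isometries. -/
theorem isQuasiIsometryOn_of_persistenceDist_le {𝕜 : Type*} [Field 𝕜] {E F : Type*} [MetricSpace E]
    [MetricSpace F] [DecidableEq F] {k : ℕ} (hk : 1 < k) {ε₁ ε₂ a : ℝ} (hε₁ : 0 ≤ ε₁)
    (ha : 1 / 2 ≤ a) {K : Finset E → Filtration E} {L : Finset F → Filtration F}
    (hK : ∀ S, IsEdgeFiltration (K S) S (edgeLength a))
    (hL : ∀ S, IsEdgeFiltration (L S) S (edgeLength a))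
    {X : Set E} {φ : E → F} (hφ : Set.InjOn φ X)
    (h : ∀ S : Finset E, (S : Set E) ⊆ X → S.card = k ∨ S.card = k - 1 →
      persistenceDist 𝕜 (K S) (L (S.image φ)) ≤ ENNReal.ofReal ε₁)
    (hX' : ∃ X' : Finset E, (X' : Set E) ⊆ X ∧ X'.card = k - 1 ∧
      ∑ p ∈ X' ×ˢ X', |dist p.1 p.2 - dist (φ p.1) (φ p.2)| ≤ ε₂) :
    IsQuasiIsometryOn φ X (56 * (k + 1) * ε₁ + 28 * ε₂) := by
  classical
  have hsum : ∀ S : Finset E, (S : Set E) ⊆ X → S.card = k ∨ S.card = k - 1 →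
      |∑ σ ∈ S.powersetCard 2, edgeLength a σ - ∑ σ ∈ (S.image φ).powersetCard 2, edgeLength a σ|
        ≤ 3 * ε₁ := by
    intro S hS hc
    rw [← (hK S).totalWeight_eq 𝕜, ← (hL _).totalWeight_eq 𝕜]
    exact abs_totalWeight_sub_le _ _ hε₁ (h S hS hc)
  -- Subtracting the estimates for `insert x A` and `A` bounds `a` times the row sum by `6 * ε₁`;
  -- dividing by `a ≥ 1 / 2` gives 12.
  have hrow : ∀ A : Finset E, (A : Set E) ⊆ X → A.card = k - 1 → ∀ x ∈ X, x ∉ A →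
      |∑ y ∈ A, (dist x y - dist (φ x) (φ y))| ≤ 12 * ε₁ := by
    intro A hA hc x hx hxA
    have h1 := hsum A hA (.inr hc)
    have h2 := hsum (insert x A) (by rw [Finset.coe_insert]; exact Set.insert_subset hx hA)
      (.inl (by rw [Finset.card_insert_of_notMem hxA]; omega))
    have hxA' : φ x ∉ A.image φ := by
      rw [Finset.mem_image]
      rintro ⟨y, hy, hyx⟩
      exact hxA (hφ (hA hy) hx hyx ▸ hy)
    rw [Finset.image_insert, sum_edgeLength_insert a hxA, sum_edgeLength_insert a hxA',
      Finset.sum_image (hφ.mono hA), add_sub_add_comm, ← mul_sub, ← Finset.sum_sub_distrib] at h2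
    have h3 := abs_sub _ _ |>.trans (add_le_add h2 h1)
    rw [add_sub_cancel_left, abs_mul, abs_of_nonneg (by linarith)] at h3
    nlinarith [abs_nonneg (∑ y ∈ A, (dist x y - dist (φ x) (φ y)))]
  obtain ⟨X', hX', hc, hε₂⟩ := hX'
  have hε₂0 : 0 ≤ ε₂ := (Finset.sum_nonneg fun _ _ => abs_nonneg _).trans hε₂
  intro x hx y hy
  refine (abs_le_of_abs_sum_le (Δ := fun x y => dist x y - dist (φ x) (φ y))
    (fun x y => by simp only [dist_comm]) (fun x => by simp) hk hrow hX' hc hε₂ hx hy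
    (by positivity)).trans ?_
  -- What remains is that `3 * (12 * ε₁) + ε₂` lies below the claimed bound, with room to spare.
  have hk2 : (2 : ℝ) ≤ k := by exact_mod_cast hk
  nlinarith

end Metric

end DistPers

/-! ### The theorem for Rips and Čech persistence -/

theorem mainTheorem3 {𝕜 : Type*} [Field 𝕜] (k : ℕ) (hk : 1 < k) (ε₁ ε₂ : ℝ) (hε₁ : 0 ≤ ε₁) :
    (∀ {E F : Type*} [MetricSpace E] [MetricSpace F] [DecidableEq F]
      (X : Set E) (Y : Set F) (φ : E → F), Set.BijOn φ X Y →
      (∀ S : Finset E, (S : Set E) ⊆ X → S.card = k ∨ S.card = k - 1 →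
        DistPers.persistenceDist 𝕜 (DistPers.skeleton 1 (DistPers.rips S))
          (DistPers.skeleton 1 (DistPers.rips (S.image φ))) ≤ ENNReal.ofReal ε₁) →
      (∃ X' : Finset E, (X' : Set E) ⊆ X ∧ X'.card = k - 1 ∧
        ∑ p ∈ X' ×ˢ X', |dist p.1 p.2 - dist (φ p.1) (φ p.2)| ≤ ε₂) →
      DistPers.IsQuasiIsometryOn φ X (56 * (k + 1) * ε₁ + 28 * ε₂)) ∧
    (∀ {E F : Type*} [NormedAddCommGroup E] [NormedSpace ℝ E]
      [NormedAddCommGroup F] [NormedSpace ℝ F] [DecidableEq F] (c : NNReal), c = 1 / 2 ∨ c = 1 →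
      ∀ (X : Set E) (Y : Set F) (φ : E → F), Set.BijOn φ X Y →
      (∀ S : Finset E, (S : Set E) ⊆ X → S.card = k ∨ S.card = k - 1 →
        DistPers.persistenceDist 𝕜 (DistPers.skeleton 1 (DistPers.cech c S))
          (DistPers.skeleton 1 (DistPers.cech c (S.image φ))) ≤ ENNReal.ofReal ε₁) →
      (∃ X' : Finset E, (X' : Set E) ⊆ X ∧ X'.card = k - 1 ∧
        ∑ p ∈ X' ×ˢ X', |dist p.1 p.2 - dist (φ p.1) (φ p.2)| ≤ ε₂) →
      DistPers.IsQuasiIsometryOn φ X (56 * (k + 1) * ε₁ + 28 * ε₂)) := by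
  constructor
  · intro E F _ _ _ X Y φ hφ h hX'
    exact DistPers.isQuasiIsometryOn_of_persistenceDist_le hk hε₁ (by norm_num)
      DistPers.isEdgeFiltration_rips DistPers.isEdgeFiltration_rips hφ.injOn h hX'
  · intro E F _ _ _ _ _ c hc X Y φ hφ h hX'
    have hc0 : 0 < c := by rcases hc with rfl | rfl <;> norm_num
    -- The two normalizations give `a = 1` and `a = 1 / 2`; the latter is the extreme case allowed.
    refine DistPers.isQuasiIsometryOn_of_persistenceDist_le hk hε₁ (a := 1 / (2 * c)) ?_
      (DistPers.isEdgeFiltration_cech hc0) (DistPers.isEdgeFiltration_cech hc0) hφ.injOn h hX'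
    rcases hc with rfl | rfl <;> norm_num
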